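/- Setting. Let $\mathcal A$ be a Banach algebra, $J\subseteq\mathbb R$ open (e.g. $J=\mathbb R$), and let $\mathcal F$ be a unital Hausdorff topological algebra of differentiable functions $J\to\mathcal A$ of the variable $x$, mapped continuously into itself by $D=d/dx$. Let $T\subseteq\mathcal F$ be a two-sided ideal with $D(T)\subseteq T$ on which $D$ is bijective with continuous inverse $D^{-1}:T\to T$. Let $Q_0\in\mathcal F$ with $D Q_0\in T$. As phase space take an open subset $M$ of the affine space $Q_0+T$ (with the topology of $T$), all of whose elements $Q$ are invertible in $\mathcal F$, with $Q\mapsto Q^{-1}$ continuous; its tangent space at each point is $T$. A vector field on $M$ is a map $M\to T$; it is smooth if it is $C^\infty$ in the sense of Michal--Bastiani (iterated directional derivatives exist and are jointly continuous). With $K'[L](Q)=\frac{\partial}{\partial\epsilon}\big|_{\epsilon=0}K(Q+\epsilon L(Q))$, a smooth vector field $S$ is a symmetry of $Q_t=K(Q)$ if $[K,S]_{\rm Lie}=S'[K]-K'[S]=0$ on $M$. A map $\Phi$ assigning to each $Q\in M$ a continuous linear operator $\Phi(Q):T\to T$ is a strong symmetry (recursion operator) of $Q_t=K(Q)$ if $\Phi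 S$ is a symmetry whenever $S$ is. On $T$ denote by $L_U,R_U$ left and right multiplication by $U\in\mathcal F$, and let $C_U=L_U-R_U$, $A_U=L_U+R_U$. Theorem 9. In every such setting: a) The right-hand side of the meta-mKdV equation $Q_t=Q_{xxx}-3Q_{xx}Q^{-1}Q_x$ is a smooth vector field on $M$, and $$\Phi(Q)=R_Q\,D^{-1}\,(D+C_V)\,(D-A_VD^{-1}A_V)\,(D-C_V)\,R_{Q^{-1}},\qquad V=Q_xQ^{-1},$$ is a strong symmetry of it. b) The right-hand side of the mirror meta-mKdV equation $\tilde Q_t=\tilde Q_{xxx}-3\tilde Q_x\tilde Q^{-1}\tilde Q_{xx}$ is a smooth vector field on $M$, and $$\tilde\Phi(\tilde Q)=L_{\tilde Q}\,D^{-1}\,(D-C_{\tilde V})\,(D-A_{\tilde V}D^{-1}A_{\tilde V})\,(D+C_{\tilde V})\,L_{\tilde Q^{-1}},\qquad \tilde V=\tilde Q^{-1}\tilde Q_x,$$ is a strong symmetry of it. -/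

import Mathlib

open Set Filter Topology

universe u v

noncomputable section

namespace MetaMKdV

/-! ### Calculus on topological vector spaces -/

/-- `w` is the derivative of `f` at `x` in the direction `v`, i.e.
`w = ∂/∂ε|_{ε = 0} f (x + ε v)`. -/
def HasDirDerivAt {E : Type u} {G : Type v} [AddCommGroup E] [Module ℝ E]
    [AddCommGroup G] [Module ℝ G] [TopologicalSpace G] (f : E → G) (x v : E) (w : G) : Prop :=
  Tendsto (fun ε : ℝ => ε⁻¹ • (f (x + ε • v) - f x)) (𝓝[≠] 0) (𝓝 w)

/-- `f` is of class `C^n` on the (open) set `U` in the sense of Michal and Bastiani: `f` is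
continuous and, if `n ≥ 1`, all directional derivatives `df (x, v)` exist and
`df : U × E → G` is of class `C^(n-1)`. -/
def IsCk {G : Type v} [AddCommGroup G] [Module ℝ G] [TopologicalSpace G] :
    ℕ → ∀ {E : Type u} [AddCommGroup E] [Module ℝ E] [TopologicalSpace E],
      (E → G) → Set E → Prop
  | 0, _, _, _, _, f, U => ContinuousOn f U
  | n + 1, E, _, _, _, f, U => ContinuousOn f U ∧
      ∃ df : E × E → G, (∀ x ∈ U, ∀ v, HasDirDerivAt f x v (df (x, v))) ∧
        IsCk n df (U ×ˢ (univ : Set E))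

section VectorFields

variable {E : Type u} [AddCommGroup E] [Module ℝ E] [TopologicalSpace E]

/-- `K` is a smooth vector field on the open subset `U` of `E` (tangent spaces are identified
with `E`). -/
def IsSmoothVectorField (U : Set E) (K : E → E) : Prop :=
  ∀ n : ℕ, IsCk n K U

/-- `w` is the value at `x` of the Lie bracket `[K, L]_Lie = L'[K] - K'[L]`. -/
def HasLieBracketAt (K L : E → E) (x w : E) : Prop :=
  ∃ a b : E, HasDirDerivAt L x (K x) a ∧ HasDirDerivAt K x (L x) b ∧ w = a - b

/-- The vector field `S` is a symmetry of the evolution equation `u_t = K(u)` on `U`: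
`S` is smooth and `[K, S]_Lie = 0` identically on `U`. -/
def IsSymmetry (U : Set E) (K S : E → E) : Prop :=
  IsSmoothVectorField U S ∧ ∀ x ∈ U, HasLieBracketAt K S x 0

/-- The operator `Φ`, which assigns to each point a bounded linear operator on the tangent space,
is a strong symmetry of `u_t = K(u)` on `U`: it maps symmetries to symmetries. -/
def IsStrongSymmetry (U : Set E) (K : E → E) (Φ : E → (E →L[ℝ] E)) : Prop :=
  ∀ S : E → E, IsSymmetry U K S → IsSymmetry U K (fun x => Φ x (S x))

end VectorFields

/-! ### Algebras of functions and phase spaces -/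

/-- `F` is realised as an algebra of differentiable functions on the open set `J ⊆ ℝ` with values
in the Banach algebra `A`, closed under the derivation `D = d/dx`, which is continuous.
(`Function.extend` continues the function by `0`; this is irrelevant since `J` is open.) -/
structure FunctionAlgebra (A : Type v) [NormedRing A] [NormedAlgebra ℝ A]
    (J : TopologicalSpace.Opens ℝ)
    (F : Type u) [Ring F] [Algebra ℝ F] [TopologicalSpace F] where
  /-- The function `J → A` given by an element of `F`. -/
  eval : F →ₐ[ℝ] (J → A)
  eval_injective : Function.Injective eval
  /-- Differentiation with respect to `x`. -/
  D : F →L[ℝ] F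
  hasDerivAt_D : ∀ (f : F) (x : J),
    HasDerivAt (Function.extend (Subtype.val : J → ℝ) (eval f) 0) (eval (D f) x) (x : ℝ)

/-- A phase space in the function algebra `F`: an open subset of an affine space `base + T`.

The tangent space `T` is an ideal of `F` on which `D` has a bounded inverse `D⁻¹` (as `D` kills
the constants, such an inverse cannot exist on all of the unital algebra `F`; the element
`base` prescribes the boundary behaviour). The phase space
consists of the functions `Q = base + h` with `h ∈ Ω`, where `Ω ⊆ T` is open; these
are invertible in `F`, with `Q⁻¹` depending continuously on `Q`. -/
structure PhaseSpace {A : Type v} [NormedRing A] [NormedAlgebra ℝ A]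
    {J : TopologicalSpace.Opens ℝ} {F : Type u} [Ring F] [Algebra ℝ F] [TopologicalSpace F]
    (X : FunctionAlgebra A J F) where
  T : Submodule ℝ F
  mul_mem_left : ∀ f : F, ∀ h ∈ T, f * h ∈ T
  mul_mem_right : ∀ f : F, ∀ h ∈ T, h * f ∈ T
  D_mem : ∀ h ∈ T, X.D h ∈ T
  /-- The operator `D⁻¹`. -/
  Dinv : T →L[ℝ] T
  D_Dinv : ∀ h : T, X.D (Dinv h : F) = h
  Dinv_D : ∀ h : T, Dinv ⟨X.D h, D_mem h h.2⟩ = h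
  base : F
  D_base_mem : X.D base ∈ T
  Ω : Set T
  isOpen_Ω : IsOpen Ω
  isUnit : ∀ h ∈ Ω, IsUnit (base + (h : F))
  continuousOn_inverse : ContinuousOn (fun h : T => Ring.inverse (base + (h : F))) Ω

namespace PhaseSpace

variable {A : Type v} [NormedRing A] [NormedAlgebra ℝ A] {J : TopologicalSpace.Opens ℝ}
  {F : Type u} [Ring F] [Algebra ℝ F] [TopologicalSpace F]
  {X : FunctionAlgebra A J F} (P : PhaseSpace X)

/-- The function `Q = base + h`. -/
def point (h : P.T) : F := P.base + (h : F)

theorem D_point_mem (h : P.T) : X.D (P.point h) ∈ P.T := by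
  rw [point, map_add]
  exact P.T.add_mem P.D_base_mem (P.D_mem h h.2)

/-- The vector field of the meta-mKdV equation `Q_t = Q_xxx - 3 Q_xx Q⁻¹ Q_x`, where
`Q = base + h` (so that `Q_t = h_t`). -/
def metaField (h : P.T) : P.T :=
  let Q := P.point h
  ⟨X.D (X.D (X.D Q)) - 3 * (X.D (X.D Q) * Ring.inverse Q * X.D Q),
    P.T.sub_mem (P.D_mem _ (P.D_mem _ (P.D_point_mem h)))
      (P.mul_mem_left _ _ (P.mul_mem_left _ _ (P.D_point_mem h)))⟩

/-- The vector field of the mirror meta-mKdV equation `Q_t = Q_xxx - 3 Q_x Q⁻¹ Q_xx`. -/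
def mirrorField (h : P.T) : P.T :=
  let Q := P.point h
  ⟨X.D (X.D (X.D Q)) - 3 * (X.D Q * Ring.inverse Q * X.D (X.D Q)),
    P.T.sub_mem (P.D_mem _ (P.D_mem _ (P.D_point_mem h)))
      (P.mul_mem_left _ _ (P.mul_mem_left _ _ (P.D_mem _ (P.D_point_mem h))))⟩

section Operators

variable [IsTopologicalRing F]

/-- Differentiation on the tangent space. -/
def D : P.T →L[ℝ] P.T where
  toFun h := ⟨X.D h, P.D_mem h h.2⟩
  map_add' a b := by ext; simp
  map_smul' c a := by ext; simp
  cont := by fun_prop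

/-- Left multiplication `L_f` by `f ∈ F` on the tangent space. -/
def L (f : F) : P.T →L[ℝ] P.T where
  toFun h := ⟨f * h, P.mul_mem_left f h h.2⟩
  map_add' a b := by ext; simp [mul_add]
  map_smul' c a := by ext; simp
  cont := by fun_prop

/-- Right multiplication `R_f` by `f ∈ F` on the tangent space. -/
def R (f : F) : P.T →L[ℝ] P.T where
  toFun h := ⟨h * f, P.mul_mem_right f h h.2⟩
  map_add' a b := by ext; simp [add_mul]
  map_smul' c a := by ext; simp
  cont := by fun_prop

/-- The commutator operator `C_f h = [f, h] = f h - h f`. -/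
def C (f : F) : P.T →L[ℝ] P.T := P.L f - P.R f

/-- The anti-commutator operator `A_f h = {f, h} = f h + h f`. -/
def AC (f : F) : P.T →L[ℝ] P.T := P.L f + P.R f

/-- `Φ(Q) = R_Q D⁻¹ (D + C_V) (D - A_V D⁻¹ A_V) (D - C_V) R_{Q⁻¹}` with `V = Q_x Q⁻¹`. -/
def recursionOp (h : P.T) : P.T →L[ℝ] P.T :=
  let Q := P.point h
  let V := X.D Q * Ring.inverse Q
  P.R Q ∘L P.Dinv ∘L (P.D + P.C V) ∘L (P.D - P.AC V ∘L P.Dinv ∘L P.AC V) ∘L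
    (P.D - P.C V) ∘L P.R (Ring.inverse Q)

/-- `Φ̃(Q) = L_Q D⁻¹ (D - C_V) (D - A_V D⁻¹ A_V) (D + C_V) L_{Q⁻¹}` with `V = Q⁻¹ Q_x`. -/
def mirrorRecursionOp (h : P.T) : P.T →L[ℝ] P.T :=
  let Q := P.point h
  let V := Ring.inverse Q * X.D Q
  P.L Q ∘L P.Dinv ∘L (P.D - P.C V) ∘L (P.D - P.AC V ∘L P.Dinv ∘L P.AC V) ∘L
    (P.D + P.C V) ∘L P.L (Ring.inverse Q)

end Operators

end PhaseSpace

end MetaMKdV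

end

/-! Put `V = Q_x Q⁻¹` and write tangent vectors as `S = y Q`. The equation becomes `Q_t = metaFlux V
* Q`, so `V` obeys the mKdV equation (`mkdv_eq`), and by `metaFlux_linearization` a smooth field `S`
commutes with the flow exactly when `y`, differentiated along the vector field, satisfies `y_t =
metaLin V y`. Each factor of the recursion operator turns one linear evolution into the next: `D -
C_V` leads from `metaLin` to `mkdvLin`, `D - A_V D⁻¹ A_V` on to `mkdvColin`, `D + C_V` on to `δ ∘
metaPre`, and `D⁻¹` back to `metaPre ∘ δ = metaLin`. Hence `u`, defined by `Φ S = u Q`, satisfies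
the same equation as `y`; `hasLieBracketAt_recursion` follows this chain. The `_intertwine` lemmas
are identities in a differential ring. The nonlocal terms are differentiated by exhibiting
primitives inside the ideal (`mkdvPrimitive`, `hasDirDerivAt_Dinv`). Part b) is part a) in the
opposite algebra. Smoothness holds because the class `IsCk` is stable under continuous linear and
bilinear maps and under inversion. -/

noncomputable section

namespace MetaMKdV

/-! ### Rules for directional derivatives. -/

section DirectionalDerivatives

variable {E : Type u} [AddCommGroup E] [Module ℝ E]
  {G : Type*} [AddCommGroup G] [Module ℝ G] [TopologicalSpace G]

theorem HasDirDerivAt.unique [T2Space G] {f : E → G} {x v : E} {w w' : G}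
    (h : HasDirDerivAt f x v w) (h' : HasDirDerivAt f x v w') : w = w' :=
  tendsto_nhds_unique h h'

theorem hasDirDerivAt_const (c : G) (x v : E) : HasDirDerivAt (fun _ : E => c) x v 0 := by
  simpa [HasDirDerivAt] using tendsto_const_nhds

theorem hasDirDerivAt_id [TopologicalSpace E] (x v : E) :
    HasDirDerivAt (fun y : E => y) x v v := by
  refine tendsto_const_nhds.congr' ?_
  filter_upwards [self_mem_nhdsWithin] with ε (hε : ε ≠ 0)
  rw [add_sub_cancel_left, inv_smul_smul₀ hε]

theorem HasDirDerivAt.congr_of_eventuallyEq {f g : E → G} {x v : E} {w : G}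
    (hf : HasDirDerivAt f x v w) (hx : g x = f x)
    (h : ∀ᶠ ε : ℝ in 𝓝[≠] 0, g (x + ε • v) = f (x + ε • v)) : HasDirDerivAt g x v w := by
  refine Tendsto.congr' ?_ hf
  filter_upwards [h] with ε hε
  rw [hε, hx]

/-- A line through an interior point stays in the set for small parameters. -/
theorem eventually_add_smul_mem [TopologicalSpace E] [ContinuousAdd E] [ContinuousSMul ℝ E]
    {U : Set E} (hU : IsOpen U) {x : E} (hx : x ∈ U) (v : E) :
    ∀ᶠ ε : ℝ in 𝓝[≠] 0, x + ε • v ∈ U := by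
  have : Tendsto (fun ε : ℝ => x + ε • v) (𝓝[≠] 0) (𝓝 x) := by
    have h : Continuous (fun ε : ℝ => x + ε • v) := by fun_prop
    simpa using (h.tendsto 0).mono_left nhdsWithin_le_nhds
  exact this.eventually (hU.mem_nhds hx)

theorem HasDirDerivAt.congr_on [TopologicalSpace E] [ContinuousAdd E] [ContinuousSMul ℝ E]
    {f g : E → G} {U : Set E} (hU : IsOpen U) (h : EqOn g f U) {x v : E} {w : G} (hx : x ∈ U)
    (hf : HasDirDerivAt f x v w) : HasDirDerivAt g x v w :=
  hf.congr_of_eventuallyEq (h hx) ((eventually_add_smul_mem hU hx v).mono fun _ hε => h hε)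

theorem HasDirDerivAt.add [ContinuousAdd G] {f g : E → G} {x v : E} {w z : G}
    (hf : HasDirDerivAt f x v w) (hg : HasDirDerivAt g x v z) :
    HasDirDerivAt (fun y => f y + g y) x v (w + z) := by
  refine Tendsto.congr (fun ε => ?_) (Tendsto.add hf hg)
  rw [← smul_add]; congr 1; dsimp only; abel

theorem HasDirDerivAt.clm_apply {H : Type*} [AddCommGroup H] [Module ℝ H] [TopologicalSpace H]
    (l : G →L[ℝ] H) {f : E → G} {x v : E} {w : G}
    (hf : HasDirDerivAt f x v w) : HasDirDerivAt (fun y => l (f y)) x v (l w) := by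
  refine Tendsto.congr (fun ε => ?_) ((l.continuous.tendsto w).comp hf)
  simp

theorem HasDirDerivAt.neg [ContinuousNeg G] {f : E → G} {x v : E} {w : G}
    (hf : HasDirDerivAt f x v w) : HasDirDerivAt (fun y => -f y) x v (-w) := by
  refine Tendsto.congr (fun ε => ?_) (Tendsto.neg hf)
  rw [← smul_neg]; congr 1; dsimp only; abel

theorem HasDirDerivAt.sub [ContinuousAdd G] [ContinuousNeg G] {f g : E → G} {x v : E} {w z : G}
    (hf : HasDirDerivAt f x v w) (hg : HasDirDerivAt g x v z) :
    HasDirDerivAt (fun y => f y - g y) x v (w - z) := by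
  simpa only [sub_eq_add_neg] using hf.add hg.neg

/-- A directionally differentiable function is continuous along the line in question. -/
theorem HasDirDerivAt.tendsto [ContinuousAdd G] [ContinuousSMul ℝ G] {f : E → G} {x v : E} {w : G}
    (hf : HasDirDerivAt f x v w) :
    Tendsto (fun ε : ℝ => f (x + ε • v)) (𝓝[≠] 0) (𝓝 (f x)) := by
  have h : Tendsto (fun ε : ℝ => ε) (𝓝[≠] 0) (𝓝 0) := nhdsWithin_le_nhds
  have := (h.smul hf).add_const (f x)
  rw [zero_smul, zero_add] at this
  refine this.congr' ?_
  filter_upwards [self_mem_nhdsWithin] with ε (hε : ε ≠ 0)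
  rw [smul_inv_smul₀ hε, sub_add_cancel]

/-- The difference quotient splits as `m (Δf/ε) (g (x + εv)) + m (f x) (Δg/ε)`. The moving factor
converges by `HasDirDerivAt.tendsto`, and joint continuity of `m` gives the limit. -/
theorem HasDirDerivAt.bilin {G₁ G₂ : Type*} [AddCommGroup G₁] [Module ℝ G₁] [TopologicalSpace G₁]
    [AddCommGroup G₂] [Module ℝ G₂] [TopologicalSpace G₂] [ContinuousAdd G₂] [ContinuousSMul ℝ G₂]
    [ContinuousAdd G]
    (m : G₁ →ₗ[ℝ] G₂ →ₗ[ℝ] G) (hm : Continuous fun p : G₁ × G₂ => m p.1 p.2)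
    {f : E → G₁} {g : E → G₂} {x v : E} {w : G₁} {z : G₂}
    (hf : HasDirDerivAt f x v w) (hg : HasDirDerivAt g x v z) :
    HasDirDerivAt (fun y => m (f y) (g y)) x v (m w (g x) + m (f x) z) := by
  have h₁ := (hm.tendsto (w, g x)).comp (hf.prodMk_nhds hg.tendsto)
  have h₂ := (hm.tendsto (f x, z)).comp
    ((tendsto_const_nhds (x := f x)).prodMk_nhds hg)
  refine Tendsto.congr (fun ε => ?_) (h₁.add h₂)
  simp only [Function.comp, map_smul, LinearMap.smul_apply, map_sub, LinearMap.sub_apply,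
    ← smul_add]
  congr 1; abel

end DirectionalDerivatives

/-! ### Closure properties of the Michal–Bastiani classes. -/

section Smoothness

/-- Needed because in the product and inverse rules the derivative contains the functions
themselves, which must then be of the lower class. -/
theorem IsCk.of_succ {G : Type v} [AddCommGroup G] [Module ℝ G] [TopologicalSpace G] {n : ℕ} :
    ∀ {E : Type u} [AddCommGroup E] [Module ℝ E] [TopologicalSpace E] {f : E → G} {U : Set E},
      IsCk (n + 1) f U → IsCk n f U := by
  induction n with
  | zero => intro E _ _ _ f U hf; exact hf.1
  | succ n ih =>
    intro E _ _ _ f U hf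
    obtain ⟨hc, df, hd, hk⟩ := hf
    exact ⟨hc, df, hd, ih hk⟩

/-- Precomposition with a continuous linear map. -/
theorem IsCk.comp_clm {G : Type v} [AddCommGroup G] [Module ℝ G] [TopologicalSpace G] {n : ℕ} :
    ∀ {E E' : Type u} [AddCommGroup E] [Module ℝ E] [TopologicalSpace E]
      [AddCommGroup E'] [Module ℝ E'] [TopologicalSpace E'] {f : E → G} {U : Set E}
      (l : E' →L[ℝ] E), IsCk n f U → IsCk n (fun y => f (l y)) (l ⁻¹' U) := by
  induction n with
  | zero =>
    intro E E' _ _ _ _ _ _ f U l hf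
    exact ContinuousOn.comp hf l.continuous.continuousOn (mapsTo_preimage _ _)
  | succ n ih =>
    intro E E' _ _ _ _ _ _ f U l hf
    obtain ⟨hc, df, hd, hk⟩ := hf
    refine ⟨hc.comp l.continuous.continuousOn (mapsTo_preimage _ _),
      fun p => df (l p.1, l p.2), fun x hx v => ?_, ?_⟩
    · simpa [HasDirDerivAt] using hd (l x) hx (l v)
    · have := ih (l.prodMap l) hk
      rw [show (l ⁻¹' U) ×ˢ (univ : Set E') = l.prodMap l ⁻¹' (U ×ˢ univ) by ext p; simp]
      exact this

/-- A function that is constant in the second variable. -/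
theorem IsCk.comp_fst {G : Type v} [AddCommGroup G] [Module ℝ G] [TopologicalSpace G] {n : ℕ}
    {E : Type u} [AddCommGroup E] [Module ℝ E] [TopologicalSpace E] {f : E → G} {U : Set E}
    (hf : IsCk n f U) : IsCk n (fun p : E × E => f p.1) (U ×ˢ univ) := by
  have := hf.comp_clm (ContinuousLinearMap.fst ℝ E E)
  rw [show U ×ˢ (univ : Set E) = ContinuousLinearMap.fst ℝ E E ⁻¹' U by ext p; simp]
  exact this

theorem isCk_const {G : Type v} [AddCommGroup G] [Module ℝ G] [TopologicalSpace G] {n : ℕ} :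
    ∀ {E : Type u} [AddCommGroup E] [Module ℝ E] [TopologicalSpace E] (c : G) (U : Set E),
      IsCk n (fun _ => c) U := by
  induction n with
  | zero => intro E _ _ _ c U; exact continuousOn_const
  | succ n ih =>
    intro E _ _ _ c U
    exact ⟨continuousOn_const, fun _ => 0, fun x _ v => hasDirDerivAt_const c x v, ih 0 _⟩

theorem isCk_clm {G : Type v} [AddCommGroup G] [Module ℝ G] [TopologicalSpace G] {n : ℕ} :
    ∀ {E : Type u} [AddCommGroup E] [Module ℝ E] [TopologicalSpace E] (l : E →L[ℝ] G) (U : Set E),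
      IsCk n (fun x => l x) U := by
  induction n with
  | zero => intro E _ _ _ l U; exact l.continuous.continuousOn
  | succ n ih =>
    intro E _ _ _ l U
    exact ⟨l.continuous.continuousOn, fun p => l p.2,
      fun x _ v => (hasDirDerivAt_id x v).clm_apply l, ih (l ∘L ContinuousLinearMap.snd ℝ E E) _⟩

theorem IsCk.clm_apply {G : Type v} [AddCommGroup G] [Module ℝ G] [TopologicalSpace G]
    {H : Type*} [AddCommGroup H] [Module ℝ H] [TopologicalSpace H] (l : G →L[ℝ] H) {n : ℕ} :
    ∀ {E : Type u} [AddCommGroup E] [Module ℝ E] [TopologicalSpace E] {f : E → G} {U : Set E},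
      IsCk n f U → IsCk n (fun x => l (f x)) U := by
  induction n with
  | zero => intro E _ _ _ f U hf; exact l.continuous.comp_continuousOn hf
  | succ n ih =>
    intro E _ _ _ f U hf
    obtain ⟨hc, df, hd, hk⟩ := hf
    exact ⟨l.continuous.comp_continuousOn hc, fun p => l (df p),
      fun x hx v => (hd x hx v).clm_apply l, ih hk⟩

theorem IsCk.add {G : Type v} [AddCommGroup G] [Module ℝ G] [TopologicalSpace G]
    [ContinuousAdd G] {n : ℕ} :
    ∀ {E : Type u} [AddCommGroup E] [Module ℝ E] [TopologicalSpace E] {f g : E → G} {U : Set E},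
      IsCk n f U → IsCk n g U → IsCk n (fun x => f x + g x) U := by
  induction n with
  | zero => intro E _ _ _ f g U hf hg; exact ContinuousOn.add hf hg
  | succ n ih =>
    intro E _ _ _ f g U hf hg
    obtain ⟨hc, df, hd, hk⟩ := hf
    obtain ⟨hc', dg, hd', hk'⟩ := hg
    exact ⟨hc.add hc', fun p => df p + dg p, fun x hx v => (hd x hx v).add (hd' x hx v),
      ih hk hk'⟩

theorem IsCk.neg {G : Type v} [AddCommGroup G] [Module ℝ G] [TopologicalSpace G]
    [IsTopologicalAddGroup G] {n : ℕ}
    {E : Type u} [AddCommGroup E] [Module ℝ E] [TopologicalSpace E] {f : E → G} {U : Set E}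
    (hf : IsCk n f U) : IsCk n (fun x => -f x) U := by
  simpa using hf.clm_apply (-ContinuousLinearMap.id ℝ G)

theorem IsCk.sub {G : Type v} [AddCommGroup G] [Module ℝ G] [TopologicalSpace G]
    [IsTopologicalAddGroup G] {n : ℕ}
    {E : Type u} [AddCommGroup E] [Module ℝ E] [TopologicalSpace E] {f g : E → G} {U : Set E}
    (hf : IsCk n f U) (hg : IsCk n g U) : IsCk n (fun x => f x - g x) U := by
  simpa only [sub_eq_add_neg] using hf.add hg.neg

theorem IsCk.bilin {G G₁ G₂ : Type*} [AddCommGroup G] [Module ℝ G] [TopologicalSpace G]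
    [ContinuousAdd G]
    [AddCommGroup G₁] [Module ℝ G₁] [TopologicalSpace G₁]
    [AddCommGroup G₂] [Module ℝ G₂] [TopologicalSpace G₂] [ContinuousAdd G₂] [ContinuousSMul ℝ G₂]
    (m : G₁ →ₗ[ℝ] G₂ →ₗ[ℝ] G) (hm : Continuous fun p : G₁ × G₂ => m p.1 p.2) {n : ℕ} :
    ∀ {E : Type u} [AddCommGroup E] [Module ℝ E] [TopologicalSpace E] {f : E → G₁} {g : E → G₂}
      {U : Set E}, IsCk n f U → IsCk n g U → IsCk n (fun x => m (f x) (g x)) U := by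
  induction n with
  | zero =>
    intro E _ _ _ f g U hf hg
    exact hm.comp_continuousOn (ContinuousOn.prodMk hf hg)
  | succ n ih =>
    intro E _ _ _ f g U hf hg
    have hf' := hf.of_succ
    have hg' := hg.of_succ
    obtain ⟨hc, df, hd, hk⟩ := hf
    obtain ⟨hc', dg, hd', hk'⟩ := hg
    exact ⟨hm.comp_continuousOn (hc.prodMk hc'),
      fun p => m (df p) (g p.1) + m (f p.1) (dg p),
      fun x hx v => (hd x hx v).bilin m hm (hd' x hx v),
      (ih hk hg'.comp_fst).add (ih hf'.comp_fst hk')⟩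

end Smoothness

/-! ### Products and inverses in a topological algebra. -/

section Rings

variable {B : Type*} [Ring B] [Algebra ℝ B] [TopologicalSpace B] [IsTopologicalRing B]
  {E : Type u} [AddCommGroup E] [Module ℝ E]

/-- Derivative of the inverse of a function, given its continuity. -/
theorem HasDirDerivAt.inverse [TopologicalSpace E] [ContinuousAdd E] [ContinuousSMul ℝ E]
    {f g : E → B} {U : Set E} (hU : IsOpen U)
    (hfg : ∀ x ∈ U, f x * g x = 1) (hgf : ∀ x ∈ U, g x * f x = 1) (hg : ContinuousOn g U)
    {x v : E} (hx : x ∈ U) {w : B} (hf : HasDirDerivAt f x v w) :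
    HasDirDerivAt g x v (-(g x * w * g x)) := by
  have hlim : Tendsto (fun ε : ℝ => g (x + ε • v)) (𝓝[≠] 0) (𝓝 (g x)) := by
    have h : Continuous (fun ε : ℝ => x + ε • v) := by fun_prop
    have h' : Tendsto (fun ε : ℝ => x + ε • v) (𝓝[≠] 0) (𝓝 x) := by
      simpa using (h.tendsto 0).mono_left nhdsWithin_le_nhds
    exact (hg.continuousAt (hU.mem_nhds hx)).tendsto.comp h'
  -- Resolvent identity: `g (x + εv) - g x = -g (x + εv) * (f (x + εv) - f x) * g x`.
  refine Tendsto.congr' ?_ (((hlim.mul hf).mul_const (g x)).neg)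
  filter_upwards [eventually_add_smul_mem hU hx v] with ε hε
  rw [mul_smul_comm, smul_mul_assoc, ← smul_neg, mul_sub, sub_mul, hgf _ hε, one_mul, mul_assoc,
    hfg x hx, mul_one, neg_sub]

variable [ContinuousSMul ℝ B]

theorem HasDirDerivAt.mul {f g : E → B} {x v : E} {w z : B}
    (hf : HasDirDerivAt f x v w) (hg : HasDirDerivAt g x v z) :
    HasDirDerivAt (fun y => f y * g y) x v (w * g x + f x * z) :=
  hf.bilin (LinearMap.mul ℝ B) continuous_mul hg

theorem IsCk.mul [TopologicalSpace E] {n : ℕ} {f g : E → B} {U : Set E}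
    (hf : IsCk n f U) (hg : IsCk n g U) : IsCk n (fun y => f y * g y) U :=
  hf.bilin (LinearMap.mul ℝ B) continuous_mul hg

variable [TopologicalSpace E] [ContinuousAdd E] [ContinuousSMul ℝ E]

/-- Bootstrapping: `dg = -g df g` is `C^n` as soon as `g` is, so mere continuity of `g` starts the
induction. -/
theorem IsCk.inverse {f g : E → B} {U : Set E} (hU : IsOpen U)
    (hfg : ∀ x ∈ U, f x * g x = 1) (hgf : ∀ x ∈ U, g x * f x = 1) (hg : ContinuousOn g U)
    {n : ℕ} (hf : IsCk n f U) : IsCk n g U := by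
  induction n with
  | zero => exact hg
  | succ n ih =>
    have hgn := (ih hf.of_succ).comp_fst
    obtain ⟨-, df, hd, hk⟩ := hf
    exact ⟨hg, fun p => -(g p.1 * df p * g p.1),
      fun x hx v => (hd x hx v).inverse hU hfg hgf hg hx, ((hgn.mul hk).mul hgn).neg⟩

end Rings

/-! ### Differential algebra of the noncommutative mKdV equation

Let `δ` be a derivation of a ring. With `V = δ Q * Q⁻¹`, the meta-mKdV equation reads
`Q_t = metaFlux V * Q`, which implies `V_t = mkdv V`. The operators `metaLin V`, `mkdvLin V` and
`mkdvColin V` govern the evolution of the intermediate stages of the factored recursion operator. -/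

section DifferentialAlgebra

variable {B Δ : Type*} [Ring B] [FunLike Δ B B] [AddMonoidHomClass Δ B B] (δ : Δ)

def metaFlux (V : B) : B := δ (δ V) + V * δ V - δ V * V - 2 • (V * V * V)

def mkdv (V : B) : B := δ (δ (δ V)) - 3 • (V * V * δ V + δ V * V * V)

/-- `metaLin V y = metaPre V (δ y)`. -/
def metaPre (V y : B) : B :=
  δ (δ y) - 3 • (δ V * y - y * δ V) - 3 • (V * V * y + y * V * V)

def metaLin (V y : B) : B := metaPre δ V (δ y)

/-- The linearisation of `mkdv` at `V`. -/
def mkdvLin (V y : B) : B :=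
  δ (δ (δ y)) - 3 • (V * V * δ y + δ y * V * V)
    - 3 • (δ V * (V * y + y * V) + (V * y + y * V) * δ V)

/-- Minus the formal transpose of `mkdvLin V` for the pairing `tr (y z)`, under which `δ` changes
sign and left and right multiplications are exchanged. It governs covectors. -/
def mkdvColin (V y : B) : B :=
  δ (δ (δ y)) - 3 • δ (V * V * y + y * V * V)
    + 3 • (V * (δ V * y + y * δ V) + (δ V * y + y * δ V) * V)

/-- The primitive of `{V, mkdvLin V y} + {mkdv V, y}`. -/
def mkdvPrimitive (V y : B) : B :=
  δ (δ (V * y + y * V)) - 3 • δ (δ V * y + y * δ V) + 3 • (δ (δ V) * y + y * δ (δ V))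
    - 3 • (V * (V * V * y + y * V * V) + (V * V * y + y * V * V) * V)

variable {δ} (hδ : ∀ f g, δ (f * g) = δ f * g + f * δ g)

include hδ

/-- Zero-curvature identity: `Q_x = V Q` and `Q_t = P Q` force `V_t = P_x + [P, V]`. -/
theorem mkdv_eq (V : B) :
    mkdv δ V = δ (metaFlux δ V) - V * metaFlux δ V + metaFlux δ V * V := by
  simp only [mkdv, metaFlux, map_add, map_sub, map_nsmul, hδ]
  noncomm_ring

/-- The left side is the time derivative of `y_x - [V, y]` when `y_t = metaLin V y` and `V_t = mkdv
V`. The other intertwining lemmas are read in the same way. -/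
theorem metaLin_intertwine (V y : B) :
    δ (metaLin δ V y) - (mkdv δ V * y + V * metaLin δ V y) + (metaLin δ V y * V + y * mkdv δ V)
      = mkdvLin δ V (δ y - V * y + y * V) := by
  simp only [mkdv, metaLin, metaPre, mkdvLin, map_add, map_sub, map_nsmul, hδ]
  noncomm_ring

/-- The time derivative of `{V, y}` is exact; this is what makes the nonlocal factor tractable. -/
theorem δ_mkdvPrimitive (V y : B) :
    δ (mkdvPrimitive δ V y) = (mkdv δ V * y + V * mkdvLin δ V y)
      + (mkdvLin δ V y * V + y * mkdv δ V) := by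
  simp only [mkdv, mkdvPrimitive, mkdvLin, map_add, map_sub, map_nsmul, hδ]
  noncomm_ring

/-- Here `z` stands for `D⁻¹ {V, y}`; only its derivative matters. -/
theorem mkdvLin_intertwine (V y z : B) (hz : δ z = V * y + y * V) :
    δ (mkdvLin δ V y) - ((mkdv δ V * z + V * mkdvPrimitive δ V y)
      + (mkdvPrimitive δ V y * V + z * mkdv δ V)) = mkdvColin δ V (δ y - (V * z + z * V)) := by
  simp only [mkdv, mkdvPrimitive, mkdvLin, mkdvColin, map_add, map_sub, map_nsmul, hδ, hz]
  noncomm_ring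

/-- Formally the transpose of `metaLin_intertwine` with `V` replaced by `-V`, a sign change that
leaves `mkdvColin` invariant. -/
theorem mkdvColin_intertwine (V y : B) :
    δ (mkdvColin δ V y) + (mkdv δ V * y + V * mkdvColin δ V y)
      - (mkdvColin δ V y * V + y * mkdv δ V) = δ (metaPre δ V (δ y + V * y - y * V)) := by
  simp only [mkdv, metaPre, mkdvColin, map_add, map_sub, map_nsmul, hδ]
  noncomm_ring

/-- `v` is the variation of `V` when `Q` varies by `y Q`; the left side is then the coefficient of
`Q` in the variation of `metaFlux V * Q`. -/
theorem metaFlux_linearization (V y v : B) (hv : v = δ y - V * y + y * V) :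
    δ (δ v) + (v * δ V + V * δ v) - (δ v * V + δ V * v)
        - 2 • ((v * V + V * v) * V + V * V * v) + metaFlux δ V * y
      = metaLin δ V y + y * metaFlux δ V := by
  subst hv
  simp only [metaFlux, metaLin, metaPre, map_add, map_sub, hδ]
  noncomm_ring

end DifferentialAlgebra

/-- An ideal of a topological differential algebra, presented as an embedded topological
bimodule `T`, with invertible derivation, together with a phase space modelled on it.
As opposed to `PhaseSpace`, this notion is symmetric under passage to the opposite algebra. -/
structure IdealModel (B : Type*) [Ring B] [Algebra ℝ B] [TopologicalSpace B]
    (T : Type u) [AddCommGroup T] [Module ℝ T] [TopologicalSpace T] where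
  δ : B →L[ℝ] B
  leibniz : ∀ f g, δ (f * g) = δ f * g + f * δ g
  ι : T →L[ℝ] B
  isEmbedding : IsEmbedding ι
  D : T →L[ℝ] T
  ι_D : ∀ h, ι (D h) = δ (ι h)
  Dinv : T →L[ℝ] T
  D_Dinv : ∀ h, D (Dinv h) = h
  Dinv_D : ∀ h, Dinv (D h) = h
  l : B → T →L[ℝ] T
  ι_l : ∀ f h, ι (l f h) = f * ι h
  r : B → T →L[ℝ] T
  ι_r : ∀ f h, ι (r f h) = ι h * f
  base : B
  dbase : T
  ι_dbase : ι dbase = δ base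
  Ω : Set T
  isOpen_Ω : IsOpen Ω
  inv : T → B
  point_mul_inv : ∀ h ∈ Ω, (base + ι h) * inv h = 1
  inv_mul_point : ∀ h ∈ Ω, inv h * (base + ι h) = 1
  continuousOn_inv : ContinuousOn inv Ω

/-! ### The recursion operator on an ideal model. -/

namespace IdealModel

variable {B : Type*} [Ring B] [Algebra ℝ B] [TopologicalSpace B]
  {T : Type u} [AddCommGroup T] [Module ℝ T] [TopologicalSpace T]
  (X : IdealModel B T)

/-- `Q = base + h`. -/
def point (h : T) : B := X.base + X.ι h

/-- The derivative of `point`, as an element of the ideal. -/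
def dpoint (h : T) : T := X.dbase + X.D h

/-- The meta-mKdV vector field. -/
def field (h : T) : T :=
  X.D (X.D (X.dpoint h)) - 3 • X.l (X.ι (X.D (X.dpoint h)) * X.inv h) (X.dpoint h)

/-- `V = Q_x Q⁻¹`. -/
def logDeriv (h : T) : B := X.δ (X.point h) * X.inv h

/-- `(D - C_V) R_{Q⁻¹}`, the first factors of the recursion operator. -/
def stage₁ (h y : T) : T :=
  X.D (X.r (X.inv h) y) - (X.l (X.logDeriv h) (X.r (X.inv h) y)
    - X.r (X.logDeriv h) (X.r (X.inv h) y))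

/-- `A_V`. -/
def anti (h y : T) : T := X.l (X.logDeriv h) y + X.r (X.logDeriv h) y

/-- `(D - A_V D⁻¹ A_V) (D - C_V) R_{Q⁻¹}`. -/
def stage₂ (h y : T) : T := X.D (X.stage₁ h y) - X.anti h (X.Dinv (X.anti h (X.stage₁ h y)))

/-- `(D + C_V) (D - A_V D⁻¹ A_V) (D - C_V) R_{Q⁻¹}`. -/
def stage₃ (h y : T) : T :=
  X.D (X.stage₂ h y) + (X.l (X.logDeriv h) (X.stage₂ h y) - X.r (X.logDeriv h) (X.stage₂ h y))

/-- The recursion operator of the meta-mKdV equation. -/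
def recursion (h y : T) : T := X.r (X.point h) (X.Dinv (X.stage₃ h y))

theorem ι_injective : Function.Injective X.ι := X.isEmbedding.injective

/-! #### The ideal as the range of `ι` -/

theorem mul_mem_range {b : B} (hb : b ∈ LinearMap.range (X.ι : T →ₗ[ℝ] B)) (f : B) :
    f * b ∈ LinearMap.range (X.ι : T →ₗ[ℝ] B) := by
  obtain ⟨h, rfl⟩ := hb
  exact ⟨X.l f h, X.ι_l f h⟩

theorem mem_range_mul {b : B} (hb : b ∈ LinearMap.range (X.ι : T →ₗ[ℝ] B)) (f : B) :
    b * f ∈ LinearMap.range (X.ι : T →ₗ[ℝ] B) := by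
  obtain ⟨h, rfl⟩ := hb
  exact ⟨X.r f h, X.ι_r f h⟩

theorem δ_mem_range {b : B} (hb : b ∈ LinearMap.range (X.ι : T →ₗ[ℝ] B)) :
    X.δ b ∈ LinearMap.range (X.ι : T →ₗ[ℝ] B) := by
  obtain ⟨h, rfl⟩ := hb
  exact ⟨X.D h, X.ι_D h⟩

theorem metaPre_mem_range (V : B) {y : B} (hy : y ∈ LinearMap.range (X.ι : T →ₗ[ℝ] B)) :
    metaPre X.δ V y ∈ LinearMap.range (X.ι : T →ₗ[ℝ] B) := by
  refine sub_mem (sub_mem (X.δ_mem_range (X.δ_mem_range hy)) (nsmul_mem (sub_mem ?_ ?_) _))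
    (nsmul_mem (add_mem ?_ ?_) _)
  all_goals first
    | exact X.mul_mem_range hy _
    | exact X.mem_range_mul hy _
    | exact X.mem_range_mul (X.mem_range_mul hy _) _

/-- Among all primitives, `D⁻¹` selects the one in the ideal, so membership identifies it. -/
theorem mkdvPrimitive_mem_range (V : B) {y : B}
    (hy : y ∈ LinearMap.range (X.ι : T →ₗ[ℝ] B)) :
    mkdvPrimitive X.δ V y ∈ LinearMap.range (X.ι : T →ₗ[ℝ] B) := by
  have h (f : B) : f * y + y * f ∈ LinearMap.range (X.ι : T →ₗ[ℝ] B) :=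
    add_mem (X.mul_mem_range hy f) (X.mem_range_mul hy f)
  have h' : V * V * y + y * V * V ∈ LinearMap.range (X.ι : T →ₗ[ℝ] B) := by
    simpa only [mul_assoc] using h (V * V)
  exact sub_mem (add_mem (sub_mem (X.δ_mem_range (X.δ_mem_range (h V)))
    (nsmul_mem (X.δ_mem_range (h _)) _)) (nsmul_mem (h _) _))
    (nsmul_mem (add_mem (X.mul_mem_range h' _) (X.mem_range_mul h' _)) _)

/-! #### Formulas in the algebra -/

theorem ι_dpoint (h : T) : X.ι (X.dpoint h) = X.δ (X.point h) := by
  simp [dpoint, point, X.ι_dbase, X.ι_D]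

theorem logDeriv_mul_point {h : T} (hh : h ∈ X.Ω) :
    X.logDeriv h * X.point h = X.δ (X.point h) := by
  rw [logDeriv, mul_assoc, point, X.inv_mul_point h hh, mul_one]

theorem ι_field {h : T} (hh : h ∈ X.Ω) :
    X.ι (X.field h) = metaFlux X.δ (X.logDeriv h) * X.point h := by
  have h₁ := X.logDeriv_mul_point hh
  have h₂ : X.δ (X.point h) * X.inv h = X.logDeriv h := rfl
  have h₃ : X.point h * X.inv h = 1 := X.point_mul_inv h hh
  simp only [field, map_sub, map_nsmul, X.ι_D, X.ι_l, ι_dpoint]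
  rw [← h₁]
  generalize X.logDeriv h = V at *
  generalize X.point h = Q at *
  generalize X.inv h = q at *
  have h₄ : X.δ (V * Q) * q = X.δ V + V * V := by
    rw [X.leibniz, ← h₁, add_mul, mul_assoc, h₃, mul_one, ← mul_assoc, mul_assoc _ Q, h₃, mul_one]
  rw [h₄]
  simp only [metaFlux, X.leibniz, map_add, ← h₁]
  noncomm_ring

theorem ι_stage₁ (h y : T) : X.ι (X.stage₁ h y) = X.δ (X.ι y * X.inv h)
    - X.logDeriv h * (X.ι y * X.inv h) + X.ι y * X.inv h * X.logDeriv h := by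
  simp only [stage₁, map_sub, X.ι_D, X.ι_l, X.ι_r]
  abel

theorem ι_anti (h y : T) :
    X.ι (X.anti h y) = X.logDeriv h * X.ι y + X.ι y * X.logDeriv h := by
  simp only [anti, map_add, X.ι_l, X.ι_r]

theorem ι_stage₂ (h y : T) : X.ι (X.stage₂ h y) = X.δ (X.ι (X.stage₁ h y))
    - (X.logDeriv h * X.ι (X.Dinv (X.anti h (X.stage₁ h y)))
      + X.ι (X.Dinv (X.anti h (X.stage₁ h y))) * X.logDeriv h) := by
  simp only [stage₂, map_sub, X.ι_D, X.ι_anti]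

theorem ι_stage₃ (h y : T) : X.ι (X.stage₃ h y) = X.δ (X.ι (X.stage₂ h y))
    + X.logDeriv h * X.ι (X.stage₂ h y) - X.ι (X.stage₂ h y) * X.logDeriv h := by
  simp only [stage₃, map_add, map_sub, X.ι_D, X.ι_l, X.ι_r]
  abel

theorem ι_recursion (h y : T) :
    X.ι (X.recursion h y) = X.ι (X.Dinv (X.stage₃ h y)) * X.point h := X.ι_r _ _

theorem δ_ι_Dinv (y : T) : X.δ (X.ι (X.Dinv y)) = X.ι y := by rw [← X.ι_D, X.D_Dinv]

/-! #### Smoothness -/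

section Smooth

variable [IsTopologicalRing B] {n : ℕ}

theorem isCk_point (U : Set T) : IsCk n X.point U := (isCk_const _ _).add (isCk_clm X.ι _)

variable [IsTopologicalAddGroup T] [ContinuousSMul ℝ T]
  {E : Type u} [AddCommGroup E] [Module ℝ E] [TopologicalSpace E] {U : Set E}

theorem isCk_l {f : E → B} {g : E → T} (hf : IsCk n f U) (hg : IsCk n g U) :
    IsCk n (fun x => X.l (f x) (g x)) U := by
  refine hf.bilin (LinearMap.mk₂ ℝ (fun b h => X.l b h) ?_ ?_ ?_ ?_) ?_ hg
  · intro a b h; apply X.ι_injective; simp only [map_add, X.ι_l, add_mul]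
  · intro c b h; apply X.ι_injective; simp only [map_smul, X.ι_l, smul_mul_assoc]
  · intro b h k; exact map_add _ _ _
  · intro c b h; exact map_smul _ _ _
  · refine X.isEmbedding.continuous_iff.mpr ?_
    have : Continuous fun p : B × T => p.1 * X.ι p.2 := by fun_prop
    refine this.congr fun p => ?_
    simp [X.ι_l]

theorem isCk_r {f : E → B} {g : E → T} (hf : IsCk n f U) (hg : IsCk n g U) :
    IsCk n (fun x => X.r (f x) (g x)) U := by
  refine hf.bilin (LinearMap.mk₂ ℝ (fun b h => X.r b h) ?_ ?_ ?_ ?_) ?_ hg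
  · intro a b h; apply X.ι_injective; simp only [map_add, X.ι_r, mul_add]
  · intro c b h; apply X.ι_injective; simp only [map_smul, X.ι_r, mul_smul_comm]
  · intro b h k; exact map_add _ _ _
  · intro c b h; exact map_smul _ _ _
  · refine X.isEmbedding.continuous_iff.mpr ?_
    have : Continuous fun p : B × T => X.ι p.2 * p.1 := by fun_prop
    refine this.congr fun p => ?_
    simp [X.ι_r]

variable [ContinuousSMul ℝ B]

theorem isCk_inv : IsCk n X.inv X.Ω :=
  (X.isCk_point _).inverse X.isOpen_Ω X.point_mul_inv X.inv_mul_point X.continuousOn_inv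

theorem isCk_logDeriv : IsCk n X.logDeriv X.Ω :=
  ((X.isCk_point _).clm_apply X.δ).mul X.isCk_inv

theorem isSmoothVectorField_field : IsSmoothVectorField X.Ω X.field := by
  intro n
  have h₁ : IsCk n X.dpoint X.Ω := (isCk_const _ _).add (isCk_clm X.D _)
  have h₂ := h₁.clm_apply X.D
  exact (h₂.clm_apply X.D).sub
    ((X.isCk_l ((h₂.clm_apply X.ι).mul X.isCk_inv) h₁).clm_apply (3 • ContinuousLinearMap.id ℝ T))

theorem isSmoothVectorField_recursion {S : T → T} (hS : IsSmoothVectorField X.Ω S) :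
    IsSmoothVectorField X.Ω fun h => X.recursion h (S h) := by
  intro n
  have hV := X.isCk_logDeriv (n := n)
  have h₀ := X.isCk_r X.isCk_inv (hS n)
  have h₁ : IsCk n (fun h => X.stage₁ h (S h)) X.Ω :=
    (h₀.clm_apply X.D).sub ((X.isCk_l hV h₀).sub (X.isCk_r hV h₀))
  have ha {f : T → T} (hf : IsCk n f X.Ω) : IsCk n (fun h => X.anti h (f h)) X.Ω :=
    (X.isCk_l hV hf).add (X.isCk_r hV hf)
  have h₂ : IsCk n (fun h => X.stage₂ h (S h)) X.Ω :=
    (h₁.clm_apply X.D).sub (ha ((ha h₁).clm_apply X.Dinv))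
  have h₃ : IsCk n (fun h => X.stage₃ h (S h)) X.Ω :=
    (h₂.clm_apply X.D).add ((X.isCk_l hV h₂).sub (X.isCk_r hV h₂))
  exact X.isCk_r (X.isCk_point _) (h₃.clm_apply X.Dinv)

end Smooth

/-! #### Directional derivatives -/

section Derivatives

theorem hasDirDerivAt_iff {f : T → T} {x v w : T} :
    HasDirDerivAt (fun h => X.ι (f h)) x v (X.ι w) ↔ HasDirDerivAt f x v w := by
  simp only [HasDirDerivAt, X.isEmbedding.tendsto_nhds_iff]
  simp [Function.comp_def]

/-- If the derivative of `g` has the primitive `b` in the ideal, then `b` is the derivative of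
`D⁻¹ g`. -/
theorem hasDirDerivAt_Dinv {g : T → T} {x v : T} {b : B}
    (hg : HasDirDerivAt (fun h => X.ι (g h)) x v (X.δ b))
    (hb : b ∈ LinearMap.range (X.ι : T →ₗ[ℝ] B)) :
    HasDirDerivAt (fun h => X.ι (X.Dinv (g h))) x v b := by
  obtain ⟨w, rfl⟩ := hb
  have hg' : HasDirDerivAt (fun h => X.ι (g h)) x v (X.ι (X.D w)) := by
    rw [X.ι_D]; exact hg
  have := (X.hasDirDerivAt_iff.mp hg').clm_apply X.Dinv
  rw [X.Dinv_D] at this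
  exact this.clm_apply X.ι

variable [IsTopologicalRing B]

theorem hasDirDerivAt_point (x v : T) : HasDirDerivAt X.point x v (X.ι v) := by
  have h := (hasDirDerivAt_const X.base x v).add ((hasDirDerivAt_id x v).clm_apply X.ι)
  rw [zero_add] at h
  exact h

variable [IsTopologicalAddGroup T] [ContinuousSMul ℝ T]

theorem hasDirDerivAt_inv {x : T} (hx : x ∈ X.Ω) (v : T) :
    HasDirDerivAt X.inv x v (-(X.inv x * X.ι v * X.inv x)) :=
  (X.hasDirDerivAt_point x v).inverse X.isOpen_Ω X.point_mul_inv X.inv_mul_point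
    X.continuousOn_inv hx

variable [ContinuousSMul ℝ B]

/-- The choice `v = y Q` eliminates `Q`: `(y Q)_x Q⁻¹ - Q_x Q⁻¹ (y Q) Q⁻¹ = y_x + y V - V y`. -/
theorem hasDirDerivAt_logDeriv {x : T} (hx : x ∈ X.Ω) {v : T} {y : B}
    (hv : X.ι v = y * X.point x) :
    HasDirDerivAt X.logDeriv x v (X.δ y - X.logDeriv x * y + y * X.logDeriv x) := by
  have h₃ : X.point x * X.inv x = 1 := X.point_mul_inv x hx
  have h : HasDirDerivAt X.logDeriv x v _ :=
    ((X.hasDirDerivAt_point x v).clm_apply X.δ).mul (X.hasDirDerivAt_inv hx v)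
  convert h using 1
  rw [hv, X.leibniz, ← X.logDeriv_mul_point hx]
  simp only [add_mul, mul_neg, mul_assoc, h₃, mul_one]
  rw [← mul_assoc (X.point x) (X.inv x), h₃, one_mul]
  abel

/-- The derivative of the meta-mKdV vector field. -/
theorem hasDirDerivAt_field {x : T} (hx : x ∈ X.Ω) {v : T} {y : B}
    (hv : X.ι v = y * X.point x) :
    HasDirDerivAt (fun h => X.ι (X.field h)) x v
      ((metaLin X.δ (X.logDeriv x) y + y * metaFlux X.δ (X.logDeriv x)) * X.point x) := by
  have hV := X.hasDirDerivAt_logDeriv hx hv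
  have hV' := hV.clm_apply X.δ
  have hV'' := hV'.clm_apply X.δ
  have hW := ((hV''.add (hV.mul hV')).sub (hV'.mul hV)).sub
    (((hV.mul hV).mul hV).clm_apply (2 • ContinuousLinearMap.id ℝ B))
  have h := (hW.mul (X.hasDirDerivAt_point x v)).congr_on X.isOpen_Ω
    (g := fun h => X.ι (X.field h)) (fun h hh => X.ι_field hh) hx
  convert h using 1
  rw [← metaFlux_linearization X.leibniz _ _ _ rfl, hv, add_mul _ _ (X.point x)]
  simp [metaFlux, mul_assoc]

theorem hasLieBracketAt_recursion [T2Space B] {S : T → T} {x : T} (hx : x ∈ X.Ω)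
    (hS : HasLieBracketAt X.field S x 0) :
    HasLieBracketAt X.field (fun h => X.recursion h (S h)) x 0 := by
  obtain ⟨a, b, ha, hb, hab⟩ := hS
  obtain rfl : a = b := (sub_eq_zero.mp hab.symm)
  have hQ : X.inv x * X.point x = 1 := X.inv_mul_point x hx
  have hQ' : X.point x * X.inv x = 1 := X.point_mul_inv x hx
  set V := X.logDeriv x with hVdef
  set y := X.ι (S x) * X.inv x with hy
  have hSx : X.ι (S x) = y * X.point x := by rw [hy, mul_assoc, hQ, mul_one]
  have hK : X.ι (X.field x) = metaFlux X.δ V * X.point x := X.ι_field hx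
  have ha' : X.ι a = (metaLin X.δ V y + y * metaFlux X.δ V) * X.point x :=
    (hb.clm_apply X.ι).unique (X.hasDirDerivAt_field hx hSx)
  have dV : HasDirDerivAt X.logDeriv x (X.field x) (mkdv X.δ V) := by
    rw [mkdv_eq X.leibniz]
    exact X.hasDirDerivAt_logDeriv hx hK
  -- The symmetry condition enters here: `a` is both `S'[K]` and `K'[S]`. The term `y * metaFlux V`
  -- in `ha'` cancels against the derivative of `Q⁻¹`.
  have d₀ : HasDirDerivAt (fun h => X.ι (S h) * X.inv h) x (X.field x) (metaLin X.δ V y) := by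
    convert (ha.clm_apply X.ι).mul (X.hasDirDerivAt_inv hx (X.field x)) using 1
    rw [ha', hK, hSx, mul_assoc _ (X.point x) (X.inv x), hQ', mul_assoc (X.inv x),
      mul_assoc _ (X.point x) (X.inv x), hQ', mul_one, mul_one, mul_neg, mul_assoc y,
      ← mul_assoc (X.point x), hQ', one_mul, add_neg_cancel_right]
  have d₁ : HasDirDerivAt (fun h => X.ι (X.stage₁ h (S h))) x (X.field x)
      (mkdvLin X.δ V (X.ι (X.stage₁ x (S x)))) := by
    simp only [ι_stage₁]
    rw [← metaLin_intertwine X.leibniz]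
    exact ((d₀.clm_apply X.δ).sub (dV.mul d₀)).add (d₀.mul dV)
  set y₁ := X.stage₁ x (S x)
  have dz : HasDirDerivAt (fun h => X.ι (X.Dinv (X.anti h (X.stage₁ h (S h))))) x (X.field x)
      (mkdvPrimitive X.δ V (X.ι y₁)) := by
    refine X.hasDirDerivAt_Dinv ?_ (X.mkdvPrimitive_mem_range _ ⟨y₁, rfl⟩)
    rw [δ_mkdvPrimitive X.leibniz]
    simp only [ι_anti]
    exact (dV.mul d₁).add (d₁.mul dV)
  have d₂ : HasDirDerivAt (fun h => X.ι (X.stage₂ h (S h))) x (X.field x)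
      (mkdvColin X.δ V (X.ι (X.stage₂ x (S x)))) := by
    simp only [ι_stage₂]
    rw [← mkdvLin_intertwine X.leibniz V (X.ι y₁) _ (by rw [δ_ι_Dinv, ι_anti])]
    exact (d₁.clm_apply X.δ).sub ((dV.mul dz).add (dz.mul dV))
  set y₂ := X.stage₂ x (S x)
  have d₃ : HasDirDerivAt (fun h => X.ι (X.stage₃ h (S h))) x (X.field x)
      (X.δ (metaPre X.δ V (X.ι (X.stage₃ x (S x))))) := by
    simp only [ι_stage₃]
    rw [← mkdvColin_intertwine X.leibniz]
    exact ((d₂.clm_apply X.δ).add (dV.mul d₂)).sub (d₂.mul dV)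
  set y₃ := X.stage₃ x (S x) with hy₃
  -- With `u = D⁻¹ y₃` this says `u_t = metaPre V y₃ = metaLin V u`, the equation satisfied by `y`.
  have d₄ := X.hasDirDerivAt_Dinv d₃ (X.metaPre_mem_range V ⟨y₃, rfl⟩)
  have d₅ := d₄.mul (X.hasDirDerivAt_point x (X.field x))
  have dK := X.hasDirDerivAt_field hx (X.ι_recursion x (S x))
  rw [← hy₃, ← hVdef, metaLin, δ_ι_Dinv] at dK
  rw [← hy₃, hK, ← mul_assoc, ← add_mul] at d₅
  -- Both derivatives have been computed in `B`; their common value must come from `T`, where the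
  -- bracket is formed.
  obtain ⟨w, hw⟩ : (metaPre X.δ V (X.ι y₃) + X.ι (X.Dinv y₃) * metaFlux X.δ V) * X.point x
      ∈ LinearMap.range (X.ι : T →ₗ[ℝ] B) :=
    X.mem_range_mul (add_mem (X.metaPre_mem_range V ⟨y₃, rfl⟩)
      (X.mem_range_mul ⟨X.Dinv y₃, rfl⟩ _)) _
  rw [← hw] at dK d₅
  refine ⟨w, w, X.hasDirDerivAt_iff.mp ?_, X.hasDirDerivAt_iff.mp dK, (sub_self w).symm⟩
  simp only [ι_recursion]
  exact d₅

theorem isStrongSymmetry [T2Space B] {Φ : T → T →L[ℝ] T} (hΦ : ∀ h y, Φ h y = X.recursion h y) :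
    IsStrongSymmetry X.Ω X.field Φ := by
  intro S hS
  simp only [hΦ]
  exact ⟨X.isSmoothVectorField_recursion hS.1,
    fun x hx => X.hasLieBracketAt_recursion hx (hS.2 x hx)⟩

end Derivatives

end IdealModel

/-- `D` is tied to `d/dx` only through evaluation, so the Leibniz rule is checked pointwise and
lifted by injectivity of `eval`. -/
theorem FunctionAlgebra.D_mul {A : Type v} [NormedRing A] [NormedAlgebra ℝ A]
    {J : TopologicalSpace.Opens ℝ} {F : Type u} [Ring F] [Algebra ℝ F] [TopologicalSpace F]
    (X : FunctionAlgebra A J F) (f g : F) : X.D (f * g) = X.D f * g + f * X.D g := by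
  apply X.eval_injective
  ext x
  have h (f : F) : Function.extend (Subtype.val : J → ℝ) (X.eval f) 0 x = X.eval f x :=
    Subtype.val_injective.extend_apply _ _ _
  have h₁ := (X.hasDerivAt_D f x).mul (X.hasDerivAt_D g x)
  have h₂ := X.hasDerivAt_D (f * g) x
  have h₃ : Function.extend (Subtype.val : J → ℝ) (X.eval (f * g)) 0 =
      Function.extend (Subtype.val : J → ℝ) (X.eval f) 0 *
        Function.extend (Subtype.val : J → ℝ) (X.eval g) 0 := by
    rw [map_mul, ← Function.extend_mul, zero_mul]
  rw [h₃] at h₂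
  have := h₂.unique h₁
  rw [h, h] at this
  simpa using this

/-! ### Phase spaces as ideal models, in the algebra and in its opposite. -/

namespace PhaseSpace

variable {A : Type v} [NormedRing A] [NormedAlgebra ℝ A] {J : TopologicalSpace.Opens ℝ}
  {F : Type u} [Ring F] [Algebra ℝ F] [TopologicalSpace F] [IsTopologicalRing F]
  {X : FunctionAlgebra A J F} (P : PhaseSpace X)

/-- A phase space as an ideal model in the algebra `F` itself. -/
def toIdealModel : IdealModel F P.T where
  δ := X.D
  leibniz := X.D_mul
  ι := P.T.subtypeL
  isEmbedding := IsEmbedding.subtypeVal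
  D := P.D
  ι_D _ := rfl
  Dinv := P.Dinv
  D_Dinv h := Subtype.ext (P.D_Dinv h)
  Dinv_D := P.Dinv_D
  l := P.L
  ι_l _ _ := rfl
  r := P.R
  ι_r _ _ := rfl
  base := P.base
  dbase := ⟨X.D P.base, P.D_base_mem⟩
  ι_dbase := rfl
  Ω := P.Ω
  isOpen_Ω := P.isOpen_Ω
  inv h := Ring.inverse (P.point h)
  point_mul_inv h hh := Ring.mul_inverse_cancel _ (P.isUnit h hh)
  inv_mul_point h hh := Ring.inverse_mul_cancel _ (P.isUnit h hh)
  continuousOn_inv := P.continuousOn_inverse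

open MulOpposite in
/-- The same ideal in the opposite algebra. -/
def toIdealModelOp : IdealModel Fᵐᵒᵖ P.T where
  δ := (opContinuousLinearEquiv ℝ : F ≃L[ℝ] Fᵐᵒᵖ) ∘L X.D ∘L
    ((opContinuousLinearEquiv ℝ : F ≃L[ℝ] Fᵐᵒᵖ).symm : Fᵐᵒᵖ →L[ℝ] F)
  leibniz f g := by
    apply unop_injective
    simp [X.D_mul, add_comm]
  ι := (opContinuousLinearEquiv ℝ : F ≃L[ℝ] Fᵐᵒᵖ) ∘L P.T.subtypeL
  isEmbedding := opHomeomorph.isEmbedding.comp IsEmbedding.subtypeVal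
  D := P.D
  ι_D _ := rfl
  Dinv := P.Dinv
  D_Dinv h := Subtype.ext (P.D_Dinv h)
  Dinv_D := P.Dinv_D
  -- The exchange of sides turns `logDeriv` into `Q⁻¹ Q_x`.
  l f := P.R f.unop
  ι_l _ _ := rfl
  r f := P.L f.unop
  ι_r _ _ := rfl
  base := op P.base
  dbase := ⟨X.D P.base, P.D_base_mem⟩
  ι_dbase := rfl
  Ω := P.Ω
  isOpen_Ω := P.isOpen_Ω
  inv h := op (Ring.inverse (P.point h))
  point_mul_inv h hh := unop_injective (Ring.inverse_mul_cancel _ (P.isUnit h hh))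
  inv_mul_point h hh := unop_injective (Ring.mul_inverse_cancel _ (P.isUnit h hh))
  continuousOn_inv := continuous_op.comp_continuousOn P.continuousOn_inverse

theorem toIdealModel_field : P.toIdealModel.field = P.metaField := by
  funext h
  apply Subtype.ext
  change X.D (X.D (X.D P.base + X.D h)) - 3 • (X.D (X.D P.base + X.D h) *
    Ring.inverse (P.point h) * (X.D P.base + X.D h)) = _
  rw [← map_add, nsmul_eq_mul]
  rfl

theorem toIdealModelOp_field : P.toIdealModelOp.field = P.mirrorField := by
  funext h
  apply Subtype.ext
  change X.D (X.D (X.D P.base + X.D h)) - 3 • ((X.D P.base + X.D h) *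
    (Ring.inverse (P.point h) * X.D (X.D P.base + X.D h))) = _
  rw [← map_add, nsmul_eq_mul, ← mul_assoc (X.D _)]
  rfl

theorem recursionOp_apply (h y : P.T) : P.recursionOp h y = P.toIdealModel.recursion h y := rfl

/-- Exchanging `L_V` and `R_V` fixes `A_V` and negates `C_V`, whence the opposite signs in the
mirror operator. -/
theorem mirrorRecursionOp_apply (h y : P.T) :
    P.mirrorRecursionOp h y = P.toIdealModelOp.recursion h y := by
  let V := Ring.inverse (P.point h) * X.D (P.point h)
  have h₁ (z : P.T) : (P.D + P.C V) z = P.D z - (P.R V z - P.L V z) := by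
    simp only [C, add_apply, sub_apply]
    abel
  have h₂ (z : P.T) : P.AC V z = P.R V z + P.L V z := add_comm _ _
  have h₃ (z : P.T) : (P.D - P.C V) z = P.D z + (P.R V z - P.L V z) := by
    simp only [C, sub_apply]
    abel
  change P.L _ (P.Dinv ((P.D - P.C V) ((P.D - P.AC V ∘L P.Dinv ∘L P.AC V)
    ((P.D + P.C V) (P.L (Ring.inverse (P.point h)) y))))) = _
  rw [h₃, h₁]
  simp only [sub_apply, ContinuousLinearMap.comp_apply, h₂]
  rfl

end PhaseSpace

end MetaMKdV

end

theorem theorem9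
    {A : Type v} [NormedRing A] [NormedAlgebra ℝ A] [CompleteSpace A]
    {J : TopologicalSpace.Opens ℝ}
    {F : Type u} [Ring F] [Algebra ℝ F] [TopologicalSpace F] [IsTopologicalRing F]
    [ContinuousSMul ℝ F] [T2Space F]
    (X : MetaMKdV.FunctionAlgebra A J F) (P : MetaMKdV.PhaseSpace X) :
    (MetaMKdV.IsSmoothVectorField P.Ω P.metaField ∧
      MetaMKdV.IsStrongSymmetry P.Ω P.metaField P.recursionOp) ∧
    (MetaMKdV.IsSmoothVectorField P.Ω P.mirrorField ∧
      MetaMKdV.IsStrongSymmetry P.Ω P.mirrorField P.mirrorRecursionOp) := by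
  rw [← P.toIdealModel_field, ← P.toIdealModelOp_field]
  exact ⟨⟨P.toIdealModel.isSmoothVectorField_field,
      P.toIdealModel.isStrongSymmetry P.recursionOp_apply⟩,
    P.toIdealModelOp.isSmoothVectorField_field,
    P.toIdealModelOp.isStrongSymmetry P.mirrorRecursionOp_apply⟩
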